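/- **Languages.** S4 formulas are $A ::= \bot \mid P \mid A\to A \mid \Box A$. LP terms are $t ::= c \mid x \mid t\cdot t \mid t+t \mid\, !t$ ($c$ constants, $x$ variables) and LP formulas are $A ::= \bot \mid P \mid A\to A \mid t{:}A$. The forgetful projection $A^\circ$ of an LP formula $A$ is the S4 formula obtained by replacing every $t{:}$ by $\Box$. The axioms of LP are the instances of some fixed finite set of axiom schemes that, with modus ponens, axiomatizes classical propositional logic, together with $t{:}F\to F$, $s{:}(F\to G)\to(t{:}F\to (s\cdot t){:}G)$, $t{:}F\to\, !t{:}t{:}F$, $s{:}F\to (s+t){:}F$ and $t{:}F\to(s+t){:}F$. **Calculi.** Sequents $\Gamma\supset\Delta$ are pairs of finite multisets of formulas. Both calculi have the axioms $P,\Gamma\supset\Delta,P$ ($P$ atomic) and $\bot,\Gamma\supset\Delta$, and the rules - $(\to\supset)$: from $\Gamma\supset\Delta,A$ and $B,\Gamma\supset\Delta$ infer $A\to B,\Gamma\supset\Delta$; - $(\supset\to)$: from $A,\Gamma\supset\Delta,B$ infer $\Gamma\supset\Delta,A\to B$. The cut-free calculus G3s has in addition - $(\Box\supset)$: from $A,\Box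 A,\Gamma\supset\Delta$ infer $\Box A,\Gamma\supset\Delta$; - $(\supset\Box)$: from $\Box\Gamma\supset A$ infer $\Gamma',\Box\Gamma\supset\Delta,\Box A$. The calculus G3lp has in addition - $(\supset:)_c$: from $\supset A$ infer $\Gamma\supset\Delta,c{:}A$, where $c$ is a constant and $A$ an axiom of LP; - $(\supset:)_t$: from $t{:}A\supset A$ infer $t{:}A,\Gamma\supset\Delta,t{:}A$; - $(:\supset)$: from $A,t{:}A,\Gamma\supset\Delta$ infer $t{:}A,\Gamma\supset\Delta$; - $(\supset!)$: from $\Gamma\supset\Delta,t{:}A,!t{:}t{:}A$ infer $\Gamma\supset\Delta,!t{:}t{:}A$; - $(\supset+)$: from $\Gamma\supset\Delta,s{:}A,t{:}A,(s+t){:}A$ infer $\Gamma\supset\Delta,(s+t){:}A$; - $(\supset\cdot)$: from $\Gamma\supset\Delta,s{:}(A\to B),(s\cdot t){:}B$ and $\Gamma\supset\Delta,t{:}A,(s\cdot t){:}B$ infer $\Gamma\supset\Delta,(s\cdot t){:}B$. **Inputs.** The input set of a G3lp proof is the set of the principal formulas $c{:}A$, $t{:}A$ of its $(\supset:)_c$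 and $(\supset:)_t$ rules. A set $\mathrm{IN}$ of such formulas is *self-referential* if, for some $n\ge 1$, it contains formulas $t_0{:}A_0,\dots,t_{n-1}{:}A_{n-1}$ such that, for every $k<n$, $t_{(k+1)\bmod n}$ is a subterm of some term occurring in $A_k$. **Prehistoric cycles.** In a G3s-proof, each $\Box$ occurrence in a premise of a rule directly corresponds to a $\Box$ occurrence in the conclusion: in a side formula to the same occurrence in that side formula, in an active formula to the same occurrence inside the respective subformula of the principal formula (in $(\Box\supset)$, $A$ corresponds to the $A$ in $\Box A$ and $\Box A$ to $\Box A$). *Families* are the classes of $\Box$ occurrences under the equivalence relation generated by direct correspondence. Polarity of occurrences is as in the formula $\bigwedge\Gamma\to\bigvee\Delta$. A *principal* family is a family of positive occurrences at least one of which is introduced (as the outermost $\Box$ of the principal formula) by a $(\supset\Box)$ rule. For principal families, $h\prec f$ means that some $(\supset\Box)$ rule introduces an occurrence of $f$ while an occurrence of $h$ is in (the left or the right side of) the premise of that rule. A *prehistoric cycle* is a list of $n\ge1$ principal families with $p_0\prec p_1\prec\dots\prec p_{n-1}\prec p_0$. **Statement.** Let $A$ be an LP formula such that $\supset A$ has a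 G3lp proof whose input set is not self-referential. Then the sequent $\supset A^\circ$ has a (cut-free) G3s-proof without prehistoric cycles. -/

import Mathlib

/-! ## Languages -/

/-- Formulas of S4 in the minimal language `⊥, P, →, □`. -/
inductive S4Formula : Type
  | bot : S4Formula
  | atom : ℕ → S4Formula
  | imp : S4Formula → S4Formula → S4Formula
  | box : S4Formula → S4Formula

/-- Justification terms `c`, `x`, `s·t`, `s+t`, `!t`. -/
inductive LPTerm : Type
  | const : ℕ → LPTerm
  | var : ℕ → LPTerm
  | app : LPTerm → LPTerm → LPTerm
  | sum : LPTerm → LPTerm → LPTerm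
  | bang : LPTerm → LPTerm

/-- Formulas of LP: `⊥`, `P`, `A → B`, `t:A`. -/
inductive LPFormula : Type
  | bot : LPFormula
  | atom : ℕ → LPFormula
  | imp : LPFormula → LPFormula → LPFormula
  | just : LPTerm → LPFormula → LPFormula

/-- The forgetful projection `A°`. -/
def LPFormula.forget : LPFormula → S4Formula
  | .bot => .bot
  | .atom P => .atom P
  | .imp A B => .imp A.forget B.forget
  | .just _ A => .box A.forget

/-- The set of subterms of a term. -/
def LPTerm.subterms : LPTerm → Set LPTerm
  | .const c => {.const c}
  | .var x => {.var x}
  | .app s t => s.subterms ∪ t.subterms ∪ {.app s t}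
  | .sum s t => s.subterms ∪ t.subterms ∪ {.sum s t}
  | .bang t => t.subterms ∪ {.bang t}

/-- The set of all subterms of the terms that occur in a formula; `t ∈ A.subterms` is what the
notation `A(t)` expresses. -/
def LPFormula.subterms : LPFormula → Set LPTerm
  | .bot => ∅
  | .atom _ => ∅
  | .imp A B => A.subterms ∪ B.subterms
  | .just t A => t.subterms ∪ A.subterms

/-! ## Axioms of LP -/

/-- Propositional schemes, with scheme variables indexed by `ℕ`. -/
inductive PropScheme : Type
  | bot : PropScheme
  | var : ℕ → PropScheme
  | imp : PropScheme → PropScheme → PropScheme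

/-- Truth value under an assignment. -/
def PropScheme.eval (v : ℕ → Prop) : PropScheme → Prop
  | .bot => False
  | .var n => v n
  | .imp F G => F.eval v → G.eval v

def PropScheme.Tautology (F : PropScheme) : Prop := ∀ v : ℕ → Prop, F.eval v

/-- Substitution of schemes for scheme variables. -/
def PropScheme.subst (σ : ℕ → PropScheme) : PropScheme → PropScheme
  | .bot => .bot
  | .var n => σ n
  | .imp F G => .imp (F.subst σ) (G.subst σ)

/-- Instance of a scheme in the language of LP. -/
def PropScheme.inst (σ : ℕ → LPFormula) : PropScheme → LPFormula
  | .bot => .bot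
  | .var n => σ n
  | .imp F G => .imp (F.inst σ) (G.inst σ)

/-- Hilbert style derivability from the substitution instances of the schemes in `X` by modus
ponens. -/
inductive PropScheme.Derivable (X : Set PropScheme) : PropScheme → Prop
  | ax {F : PropScheme} (hF : F ∈ X) (σ : ℕ → PropScheme) : Derivable X (F.subst σ)
  | mp {F G : PropScheme} : Derivable X (.imp F G) → Derivable X F → Derivable X G

/-- `X` is a finite set of axiom schemes of classical propositional logic (sound and complete
together with modus ponens). -/
def AxiomatizesClassical (X : Set PropScheme) : Prop :=
  X.Finite ∧ ∀ F : PropScheme, PropScheme.Derivable X F ↔ F.Tautology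

/-- The axioms A0--A4 of LP, where A0 is given by the set `X` of propositional schemes. -/
inductive LPAxiom (X : Set PropScheme) : LPFormula → Prop
  | prop {F : PropScheme} (hF : F ∈ X) (σ : ℕ → LPFormula) : LPAxiom X (F.inst σ)
  | reflection (t : LPTerm) (F : LPFormula) : LPAxiom X (.imp (.just t F) F)
  | application (s t : LPTerm) (F G : LPFormula) :
      LPAxiom X (.imp (.just s (.imp F G)) (.imp (.just t F) (.just (.app s t) G)))
  | proofChecker (t : LPTerm) (F : LPFormula) :
      LPAxiom X (.imp (.just t F) (.just (.bang t) (.just t F)))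
  | sumLeft (s t : LPTerm) (F : LPFormula) :
      LPAxiom X (.imp (.just s F) (.just (.sum s t) F))
  | sumRight (s t : LPTerm) (F : LPFormula) :
      LPAxiom X (.imp (.just t F) (.just (.sum s t) F))

/-! ## The calculus G3lp -/

/-- Proof trees of G3lp; `G3lp X Γ Δ` is the type of proofs of the sequent `Γ ⊃ Δ`, where `Γ` and
`Δ` are multisets of LP formulas. -/
inductive G3lp (X : Set PropScheme) : Multiset LPFormula → Multiset LPFormula → Type
  /-- (Ax) -/
  | ax (Γ Δ : Multiset LPFormula) (P : ℕ) : G3lp X (.atom P ::ₘ Γ) (.atom P ::ₘ Δ)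
  /-- (⊥ ⊃) -/
  | botL (Γ Δ : Multiset LPFormula) : G3lp X (.bot ::ₘ Γ) Δ
  /-- (→ ⊃) -/
  | impL (Γ Δ : Multiset LPFormula) (A B : LPFormula) :
      G3lp X Γ (A ::ₘ Δ) → G3lp X (B ::ₘ Γ) Δ → G3lp X (.imp A B ::ₘ Γ) Δ
  /-- (⊃ →) -/
  | impR (Γ Δ : Multiset LPFormula) (A B : LPFormula) :
      G3lp X (A ::ₘ Γ) (B ::ₘ Δ) → G3lp X Γ (.imp A B ::ₘ Δ)
  /-- (⊃ :)_c -/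
  | justC (Γ Δ : Multiset LPFormula) (c : ℕ) (A : LPFormula) (hA : LPAxiom X A) :
      G3lp X 0 {A} → G3lp X Γ (.just (.const c) A ::ₘ Δ)
  /-- (⊃ :)_t -/
  | justT (Γ Δ : Multiset LPFormula) (t : LPTerm) (A : LPFormula) :
      G3lp X {.just t A} {A} → G3lp X (.just t A ::ₘ Γ) (.just t A ::ₘ Δ)
  /-- (: ⊃) -/
  | justL (Γ Δ : Multiset LPFormula) (t : LPTerm) (A : LPFormula) :
      G3lp X (A ::ₘ .just t A ::ₘ Γ) Δ → G3lp X (.just t A ::ₘ Γ) Δ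
  /-- (⊃ !) -/
  | bangR (Γ Δ : Multiset LPFormula) (t : LPTerm) (A : LPFormula) :
      G3lp X Γ (.just t A ::ₘ .just (.bang t) (.just t A) ::ₘ Δ) →
      G3lp X Γ (.just (.bang t) (.just t A) ::ₘ Δ)
  /-- (⊃ +) -/
  | sumR (Γ Δ : Multiset LPFormula) (s t : LPTerm) (A : LPFormula) :
      G3lp X Γ (.just s A ::ₘ .just t A ::ₘ .just (.sum s t) A ::ₘ Δ) →
      G3lp X Γ (.just (.sum s t) A ::ₘ Δ)
  /-- (⊃ ·) -/
  | appR (Γ Δ : Multiset LPFormula) (s t : LPTerm) (A B : LPFormula) :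
      G3lp X Γ (.just s (.imp A B) ::ₘ .just (.app s t) B ::ₘ Δ) →
      G3lp X Γ (.just t A ::ₘ .just (.app s t) B ::ₘ Δ) →
      G3lp X Γ (.just (.app s t) B ::ₘ Δ)

/-- The inputs of a G3lp proof: the principal formulas of its (⊃ :)_c and (⊃ :)_t rules. -/
def G3lp.inputs {X : Set PropScheme} : {Γ Δ : Multiset LPFormula} → G3lp X Γ Δ → Set LPFormula
  | _, _, .ax _ _ _ => ∅
  | _, _, .botL _ _ => ∅
  | _, _, .impL _ _ _ _ d e => d.inputs ∪ e.inputs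
  | _, _, .impR _ _ _ _ d => d.inputs
  | _, _, .justC _ _ c A _ d => insert (.just (.const c) A) d.inputs
  | _, _, .justT _ _ t A d => insert (.just t A) d.inputs
  | _, _, .justL _ _ _ _ d => d.inputs
  | _, _, .bangR _ _ _ _ d => d.inputs
  | _, _, .sumR _ _ _ _ _ d => d.inputs
  | _, _, .appR _ _ _ _ _ _ d e => d.inputs ∪ e.inputs

/-- A set of inputs is self-referential if it contains formulas
`t₀:A₀(t₁), t₁:A₁(t₂), …, tₙ₋₁:Aₙ₋₁(t₀)` for some `n ≥ 1`. -/
def SelfReferential (I : Set LPFormula) : Prop :=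
  ∃ n : ℕ, 0 < n ∧ ∃ (t : ℕ → LPTerm) (A : ℕ → LPFormula),
    ∀ k < n, LPFormula.just (t k) (A k) ∈ I ∧ t ((k + 1) % n) ∈ (A k).subterms

/-! ## The cut-free calculus G3s

Correspondence is a relation between *occurrences*, so the multisets on the two sides of a sequent
are presented by lists: a formula occurrence is a position in one of the lists. The rules apply to
formulas at arbitrary positions, so the order of the lists is immaterial. -/

structure S4Sequent : Type where
  ant : List S4Formula
  suc : List S4Formula

/-- The two sides of a sequent. -/
inductive SeqSide : Type
  | ant
  | suc

def S4Sequent.on (S : S4Sequent) : SeqSide → List S4Formula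
  | .ant => S.ant
  | .suc => S.suc

/-- Trees of rule applications; each node carries its sequent `S` (the conclusion) and the position
`i` of the principal formula. In (⊃ □), `ks` lists the positions of the side formulas `□Γ` in the
antecedent of the conclusion; all other formulas except the principal one are weakening formulas. -/
inductive G3sTree : Type
  | ax (S : S4Sequent) : G3sTree
  | botL (S : S4Sequent) : G3sTree
  | impL (S : S4Sequent) (i : ℕ) (T₁ T₂ : G3sTree) : G3sTree
  | impR (S : S4Sequent) (i : ℕ) (T : G3sTree) : G3sTree
  | boxL (S : S4Sequent) (i : ℕ) (T : G3sTree) : G3sTree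
  | boxR (S : S4Sequent) (i : ℕ) (ks : List ℕ) (T : G3sTree) : G3sTree

namespace G3sTree

/-- The root sequent. -/
def root : G3sTree → S4Sequent
  | ax S => S
  | botL S => S
  | impL S _ _ _ => S
  | impR S _ _ => S
  | boxL S _ _ => S
  | boxR S _ _ _ => S

/-- Every node is a correct application of a rule of G3s:
* (Ax) `P, Γ ⊃ Δ, P` with `P` atomic, and (⊥ ⊃) `⊥, Γ ⊃ Δ`;
* (→ ⊃) from `Γ ⊃ Δ, A` and `B, Γ ⊃ Δ` infer `A → B, Γ ⊃ Δ`;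
* (⊃ →) from `A, Γ ⊃ Δ, B` infer `Γ ⊃ Δ, A → B`;
* (□ ⊃) from `A, □A, Γ ⊃ Δ` infer `□A, Γ ⊃ Δ`;
* (⊃ □) from `□Γ ⊃ A` infer `Γ', □Γ ⊃ Δ, □A`. -/
def Correct : G3sTree → Prop
  | ax S => ∃ P : ℕ, S4Formula.atom P ∈ S.ant ∧ S4Formula.atom P ∈ S.suc
  | botL S => S4Formula.bot ∈ S.ant
  | impL S i T₁ T₂ => ∃ A B : S4Formula, S.ant[i]? = some (.imp A B) ∧
      T₁.root = ⟨S.ant.eraseIdx i, A :: S.suc⟩ ∧ T₂.root = ⟨B :: S.ant.eraseIdx i, S.suc⟩ ∧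
      T₁.Correct ∧ T₂.Correct
  | impR S i T => ∃ A B : S4Formula, S.suc[i]? = some (.imp A B) ∧
      T.root = ⟨A :: S.ant, B :: S.suc.eraseIdx i⟩ ∧ T.Correct
  | boxL S i T => ∃ A : S4Formula, S.ant[i]? = some (.box A) ∧
      T.root = ⟨A :: S.ant, S.suc⟩ ∧ T.Correct
  | boxR S i ks T => ∃ (A : S4Formula) (G : List S4Formula), S.suc[i]? = some (.box A) ∧
      ks.Nodup ∧ ks.map (fun k => S.ant[k]?) = G.map (fun B => some (S4Formula.box B)) ∧
      T.root = ⟨G.map S4Formula.box, [A]⟩ ∧ T.Correct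

/-- `T` is a G3s-proof of the sequent `S`. -/
def IsProofOf (T : G3sTree) (S : S4Sequent) : Prop := T.Correct ∧ T.root = S

/-- The subtree at a node; a node is addressed by the path from the root, where `false` goes to the
first (or only) premise and `true` to the second one. -/
def subtree : G3sTree → List Bool → Option G3sTree
  | T, [] => some T
  | impL _ _ T₁ _, false :: a => T₁.subtree a
  | impL _ _ _ T₂, true :: a => T₂.subtree a
  | impR _ _ T, false :: a => T.subtree a
  | boxL _ _ T, false :: a => T.subtree a
  | boxR _ _ _ T, false :: a => T.subtree a
  | _, _ => none

end G3sTree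

/-! ## Occurrences, polarity, correspondence, families -/

/-- Steps from a formula to an immediate subformula. -/
inductive SubStep : Type
  | impLeft
  | impRight
  | inner

/-- The subformula occurrence at a path. -/
def S4Formula.subAt : S4Formula → List SubStep → Option S4Formula
  | A, [] => some A
  | .imp A _, .impLeft :: p => A.subAt p
  | .imp _ B, .impRight :: p => B.subAt p
  | .box A, .inner :: p => A.subAt p
  | _, _ => none

/-- Polarity of a subformula occurrence relative to the formula (`true` is positive). -/
def pathPolarity : List SubStep → Bool
  | [] => true
  | .impLeft :: p => !(pathPolarity p)
  | .impRight :: p => pathPolarity p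
  | .inner :: p => pathPolarity p

/-- A subformula occurrence in a proof tree: a node, a formula of the sequent at that node (by side
and position), and a path to a subformula of it. -/
structure ProofOcc : Type where
  node : List Bool
  side : SeqSide
  pos : ℕ
  path : List SubStep

/-- Polarity relative to the sequent. -/
def ProofOcc.Positive (o : ProofOcc) : Prop :=
  match o.side with
  | .ant => pathPolarity o.path = false
  | .suc => pathPolarity o.path = true

namespace G3sTree

/-- `o` is an occurrence of a formula `□B`, i.e. of a `□` symbol, in `T`. -/
def IsBoxOcc (T : G3sTree) (o : ProofOcc) : Prop :=
  ∃ (U : G3sTree) (F B : S4Formula), T.subtree o.node = some U ∧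
    (U.root.on o.side)[o.pos]? = some F ∧ F.subAt o.path = some (.box B)

/-- The `□` occurrences in `T`. -/
def BoxOcc (T : G3sTree) : Type := {o : ProofOcc // T.IsBoxOcc o}

/-- The position in a list of the `j`-th entry that remains after deleting entry `i`. -/
def skipIdx (i j : ℕ) : ℕ := if j < i then j else j + 1

/-- For the last rule of a tree: the subformula occurrence (side, position, path) of the conclusion
to which the formula at a given side and position of premise `false` (first) or `true` (second)
directly corresponds. Side formulas go to themselves, active formulas to the respective subformula
of the principal formula. -/
def origin : G3sTree → Bool → SeqSide → ℕ → Option (SeqSide × ℕ × List SubStep)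
  | impL _ i _ _, false, .ant, j => some (.ant, skipIdx i j, [])
  | impL _ i _ _, false, .suc, 0 => some (.ant, i, [.impLeft])
  | impL _ _ _ _, false, .suc, j + 1 => some (.suc, j, [])
  | impL _ i _ _, true, .ant, 0 => some (.ant, i, [.impRight])
  | impL _ i _ _, true, .ant, j + 1 => some (.ant, skipIdx i j, [])
  | impL _ _ _ _, true, .suc, j => some (.suc, j, [])
  | impR _ i _, false, .ant, 0 => some (.suc, i, [.impLeft])
  | impR _ _ _, false, .ant, j + 1 => some (.ant, j, [])
  | impR _ i _, false, .suc, 0 => some (.suc, i, [.impRight])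
  | impR _ i _, false, .suc, j + 1 => some (.suc, skipIdx i j, [])
  | boxL _ i _, false, .ant, 0 => some (.ant, i, [.inner])
  | boxL _ _ _, false, .ant, j + 1 => some (.ant, j, [])
  | boxL _ _ _, false, .suc, j => some (.suc, j, [])
  | boxR _ _ ks _, false, .ant, j => (ks[j]?).map (fun k => (.ant, k, []))
  | boxR _ i _ _, false, .suc, 0 => some (.suc, i, [.inner])
  | _, _, _, _ => none

/-- Direct correspondence of a `□` occurrence `x` in a premise with a `□` occurrence `y` in the
conclusion of the same rule application. -/
def DirectCorr (T : G3sTree) (x y : T.BoxOcc) : Prop :=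
  ∃ (U : G3sTree) (b : Bool) (p : List SubStep), T.subtree y.1.node = some U ∧
    x.1.node = y.1.node ++ [b] ∧
    U.origin b x.1.side x.1.pos = some (y.1.side, y.1.pos, p) ∧ y.1.path = p ++ x.1.path

/-- Families: the classes of `□` occurrences for the equivalence relation generated by direct
correspondence. -/
def Family (T : G3sTree) : Type := Quot T.DirectCorr

/-- The family of a `□` occurrence. -/
def family (T : G3sTree) (x : T.BoxOcc) : T.Family := Quot.mk T.DirectCorr x

/-- `x` is the `□` occurrence introduced by a (⊃ □) rule with conclusion at the node `a`. -/
def IntroducedAt (T : G3sTree) (a : List Bool) (x : T.BoxOcc) : Prop :=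
  ∃ (S : S4Sequent) (i : ℕ) (ks : List ℕ) (U : G3sTree),
    T.subtree a = some (boxR S i ks U) ∧ x.1 = ⟨a, .suc, i, []⟩

/-- Principal (positive) families: positive families with an occurrence that is introduced by a
(⊃ □) rule. -/
def Principal (T : G3sTree) (f : T.Family) : Prop :=
  (∀ x : T.BoxOcc, T.family x = f → x.1.Positive) ∧
    ∃ (a : List Bool) (x : T.BoxOcc), T.IntroducedAt a x ∧ T.family x = f

/-- `h` occurs on the side `s` of the premise of a (⊃ □) rule that introduces an occurrence of
`f`. -/
def PrehistoricOn (T : G3sTree) (s : SeqSide) (h f : T.Family) : Prop :=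
  T.Principal h ∧ T.Principal f ∧ ∃ (a : List Bool) (x y : T.BoxOcc),
    T.IntroducedAt a x ∧ T.family x = f ∧
    y.1.node = a ++ [false] ∧ y.1.side = s ∧ T.family y = h

/-- The prehistoric relation `h ≺ f`: the union of the left and the right one. -/
def Prehistoric (T : G3sTree) (h f : T.Family) : Prop :=
  T.PrehistoricOn .ant h f ∨ T.PrehistoricOn .suc h f

/-- There are principal families with `p₀ ≺ p₁ ≺ ⋯ ≺ pₙ₋₁ ≺ p₀` for some `n ≥ 1`. -/
def HasPrehistoricCycle (T : G3sTree) : Prop :=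
  ∃ n : ℕ, 0 < n ∧ ∃ p : ℕ → T.Family, ∀ k < n, T.Prehistoric (p k) (p ((k + 1) % n))

end G3sTree

open Relation

/-! ## Cyclic chains -/

/-! Let `I` be the input set. The G3s-proof sought has a justification term on every box, constant
along direct correspondence, so that each family has one term. In it (⊃ □) may introduce `t` only if
some subterm of `t` is the term of an input, and only if each term that is positive in the premise
is inactive or `Below I` the term `t`: either it occurs in a formula `C` with an input `s:C`, `s` a
subterm of `t` (`Feeds`), or it is a proper subterm of `t`. Terms of principal families are active,
so a prehistoric cycle gives a cycle of `Below I`. Proper-subterm steps are absorbed by `Feeds`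
steps and cannot close up alone; a cycle of `Feeds I` is self-reference
(`selfReferential_of_transGen_below`).

That such a proof exists is a completeness argument, so no syntactic transformation of G3lp-proofs
is needed. If the annotated calculus does not derive `⊃ A`, saturation yields a world with `A` on
its false side (`exists_world`). At a world each formula has a truth and a falsity condition, at
least one of which holds. A formula `t:A` may satisfy both, and it counts as false whenever the
restrictions on (⊃ □) forbid introducing it. The overlap is harmless because G3lp has no cut and
only atomic axioms, and inputs always obey the restrictions. Hence G3lp is sound for these worlds
(`World.sound`), and a G3lp-proof of `⊃ A` excludes the world above. -/

theorem transGen_of_cycle {α : Type*} {r : α → α → Prop} {n : ℕ} (hn : 0 < n) {p : ℕ → α}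
    (h : ∀ k < n, r (p k) (p ((k + 1) % n))) : TransGen r (p 0) (p 0) := by
  have key : ∀ k < n, ReflTransGen r (p 0) (p k) := by
    intro k
    induction k with
    | zero => intro _; exact .refl
    | succ k ih =>
      intro hk
      have h1 := h k (by omega)
      rw [Nat.mod_eq_of_lt hk] at h1
      exact (ih (by omega)).tail h1
  have h1 := h (n - 1) (by omega)
  rw [Nat.sub_add_cancel hn, Nat.mod_self] at h1
  exact TransGen.tail' (key (n - 1) (by omega)) h1

theorem exists_path_of_transGen {α : Type*} {r : α → α → Prop} {a b : α} (h : TransGen r a b) :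
    ∃ n : ℕ, 0 < n ∧ ∃ p : ℕ → α, p 0 = a ∧ p n = b ∧ ∀ k < n, r (p k) (p (k + 1)) := by
  induction h with
  | @single b hab =>
    refine ⟨1, one_pos, fun k => if k = 0 then a else b, by simp, by simp, ?_⟩
    intro k hk
    obtain rfl : k = 0 := by omega
    simpa using hab
  | @tail b c _ hbc ih =>
    obtain ⟨n, hn, p, h0, hb, hp⟩ := ih
    refine ⟨n + 1, by omega, fun k => if k ≤ n then p k else c, by simpa using h0, by simp, ?_⟩
    intro k hk
    rcases Nat.lt_succ_iff_lt_or_eq.1 hk with hk' | rfl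
    · have h2 : k + 1 ≤ n := hk'
      simpa [hk'.le, h2] using hp k hk'
    · simpa [hb] using hbc

theorem exists_cycle_of_transGen {α : Type*} {r : α → α → Prop} {a : α} (h : TransGen r a a) :
    ∃ n : ℕ, 0 < n ∧ ∃ p : ℕ → α, ∀ k < n, r (p k) (p ((k + 1) % n)) := by
  obtain ⟨n, hn, p, h0, hb, hp⟩ := exists_path_of_transGen h
  refine ⟨n, hn, p, fun k hk => ?_⟩
  rcases (show k + 1 ≤ n from hk).lt_or_eq with hk' | hk'
  · rw [Nat.mod_eq_of_lt hk']
    exact hp k hk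
  · have := hp k hk
    rwa [hk', Nat.mod_self, h0, ← hb, ← hk']

/-! ## Terms -/

namespace LPTerm

theorem self_mem_subterms (t : LPTerm) : t ∈ t.subterms := by
  cases t <;> simp [subterms]

theorem subterms_trans {r s t : LPTerm} (hrs : r ∈ s.subterms) (hst : s ∈ t.subterms) :
    r ∈ t.subterms := by
  induction t with
  | const c => simp only [subterms, Set.mem_singleton_iff] at hst; subst hst; exact hrs
  | var c => simp only [subterms, Set.mem_singleton_iff] at hst; subst hst; exact hrs
  | app a b iha ihb =>
    simp only [subterms, Set.mem_union, Set.mem_singleton_iff] at hst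
    rcases hst with (h | h) | rfl
    · exact .inl (.inl (iha h))
    · exact .inl (.inr (ihb h))
    · exact hrs
  | sum a b iha ihb =>
    simp only [subterms, Set.mem_union, Set.mem_singleton_iff] at hst
    rcases hst with (h | h) | rfl
    · exact .inl (.inl (iha h))
    · exact .inl (.inr (ihb h))
    · exact hrs
  | bang a ih =>
    simp only [subterms, Set.mem_union, Set.mem_singleton_iff] at hst
    rcases hst with h | rfl
    · exact .inl (ih h)
    · exact hrs

theorem sizeOf_le_of_mem_subterms {s t : LPTerm} (h : s ∈ t.subterms) :
    s = t ∨ sizeOf s < sizeOf t := by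
  induction t with
  | const c => exact .inl h
  | var c => exact .inl h
  | app a b iha ihb =>
    rcases h with (h | h) | h
    · right; rcases iha h with rfl | h <;> (simp only [app.sizeOf_spec]; omega)
    · right; rcases ihb h with rfl | h <;> (simp only [app.sizeOf_spec]; omega)
    · exact .inl h
  | sum a b iha ihb =>
    rcases h with (h | h) | h
    · right; rcases iha h with rfl | h <;> (simp only [sum.sizeOf_spec]; omega)
    · right; rcases ihb h with rfl | h <;> (simp only [sum.sizeOf_spec]; omega)
    · exact .inl h
  | bang a ih =>
    rcases h with h | h
    · right; rcases ih h with rfl | h <;> simp only [bang.sizeOf_spec] <;> omega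
    · exact .inl h

/-- `s` is a proper subterm of `t`. -/
def ProperSub (s t : LPTerm) : Prop := s ∈ t.subterms ∧ sizeOf s < sizeOf t

theorem ProperSub.trans {r s t : LPTerm} (h₁ : ProperSub r s) (h₂ : s ∈ t.subterms) :
    ProperSub r t := by
  refine ⟨subterms_trans h₁.1 h₂, ?_⟩
  rcases sizeOf_le_of_mem_subterms h₂ with rfl | h
  · exact h₁.2
  · exact h₁.2.trans h

/-- No input in `I` justifies a subterm of `t`. -/
def Inactive (I : Set LPFormula) (t : LPTerm) : Prop :=
  ∀ s ∈ t.subterms, ∀ C, LPFormula.just s C ∉ I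

/-- Some input `s:C(u)` in `I` has its term `s` inside `t`. -/
def Feeds (I : Set LPFormula) (u t : LPTerm) : Prop :=
  ∃ s C, LPFormula.just s C ∈ I ∧ s ∈ t.subterms ∧ u ∈ C.subterms

/-- The relation that bounds the prehistory of a `□` realized by `t`. -/
def Below (I : Set LPFormula) (u t : LPTerm) : Prop := Feeds I u t ∨ ProperSub u t

variable {I : Set LPFormula} {s t u : LPTerm}

theorem Inactive.of_subterm (h : Inactive I t) (hs : s ∈ t.subterms) : Inactive I s :=
  fun r hr => h r (subterms_trans hr hs)

theorem Feeds.mono (h : Feeds I u s) (hs : s ∈ t.subterms) : Feeds I u t := by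
  obtain ⟨r, C, hI, hr, hu⟩ := h
  exact ⟨r, C, hI, subterms_trans hr hs, hu⟩

theorem Below.mono (h : Below I u s) (hs : s ∈ t.subterms) : Below I u t :=
  h.imp (fun h => h.mono hs) (fun h => h.trans hs)

end LPTerm

open LPTerm

theorem LPFormula.subterms_trans {s t : LPTerm} {A : LPFormula} (hst : s ∈ t.subterms)
    (ht : t ∈ A.subterms) : s ∈ A.subterms := by
  induction A with
  | bot => exact ht
  | atom P => exact ht
  | imp A B ihA ihB => exact ht.imp ihA ihB
  | just r A ih => exact ht.imp (fun h => LPTerm.subterms_trans hst h) ih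

theorem LPTerm.feeds_of_subterm_feeds {I : Set LPFormula} {r u t : LPTerm} (hr : r ∈ u.subterms)
    (h : Feeds I u t) : Feeds I r t := by
  obtain ⟨s, C, hI, hs, hu⟩ := h
  exact ⟨s, C, hI, hs, LPFormula.subterms_trans hr hu⟩

/-- A proper-subterm step is absorbed by an adjacent `Feeds` step on either side: subterms of a term
in `C` occur in `C`, and an input term inside a subterm of `t` is inside `t`. Only chains made of
proper subterms alone escape. -/
theorem LPTerm.transGen_feeds_of_below {I : Set LPFormula} {u t : LPTerm}
    (h : TransGen (Below I) u t) : TransGen (Feeds I) u t ∨ ProperSub u t := by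
  induction h with
  | single h => exact h.imp .single id
  | tail _ h ih =>
    rcases h with h | h
    · rcases ih with ih | ih
      · exact .inl (ih.tail h)
      · exact .inl (.single (feeds_of_subterm_feeds ih.1 h))
    · rcases ih with ih | ih
      · obtain ⟨c, hc, hcb⟩ := TransGen.tail'_iff.1 ih
        exact .inl (TransGen.tail' hc (hcb.mono h.1))
      · exact .inr (ih.trans h.1)

theorem selfReferential_of_transGen_feeds {I : Set LPFormula} {t : LPTerm}
    (h : TransGen (Feeds I) t t) : SelfReferential I := by
  -- `Feeds` points from a term in an input formula to a term containing the input's own term, so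
  -- self-reference runs through the cycle backwards.
  obtain ⟨n, hn, p, hp⟩ := exists_cycle_of_transGen (transGen_swap.2 h)
  have hp' : ∀ k, ∃ s C, k < n → LPFormula.just s C ∈ I ∧ s ∈ (p k).subterms ∧
      p ((k + 1) % n) ∈ C.subterms := by
    intro k
    by_cases hk : k < n
    · obtain ⟨s, C, h⟩ := hp k hk
      exact ⟨s, C, fun _ => h⟩
    -- Indices outside the cycle get dummy values.
    · exact ⟨.const 0, .bot, fun h => absurd h hk⟩
  choose s C hsC using hp'
  refine ⟨n, hn, s, C, fun k hk => ⟨(hsC k hk).1, ?_⟩⟩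
  exact LPFormula.subterms_trans (hsC _ (Nat.mod_lt _ hn)).2.1 (hsC k hk).2.2

theorem selfReferential_of_transGen_below {I : Set LPFormula} {t : LPTerm}
    (h : TransGen (Below I) t t) : SelfReferential I := by
  rcases transGen_feeds_of_below h with h | h
  · exact selfReferential_of_transGen_feeds h
  · exact absurd h.2 (lt_irrefl _)

/-! ## Guarded formulas -/

/-- The subformula occurrence at a path. -/
def LPFormula.subAt : LPFormula → List SubStep → Option LPFormula
  | A, [] => some A
  | .imp A _, .impLeft :: p => A.subAt p
  | .imp _ B, .impRight :: p => B.subAt p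
  | .just _ A, .inner :: p => A.subAt p
  | _, _ => none

namespace LPFormula

@[simp] theorem subAt_nil (A : LPFormula) : A.subAt [] = some A := by
  cases A <;> rfl

theorem mem_subterms_of_subAt {A B : LPFormula} {p : List SubStep} {u : LPTerm}
    (h : A.subAt p = some (.just u B)) : u ∈ A.subterms := by
  induction p generalizing A with
  | nil =>
    rw [subAt_nil, Option.some.injEq] at h
    subst h
    exact .inl u.self_mem_subterms
  | cons a p ih =>
    cases A <;> cases a <;> simp only [subAt, reduceCtorEq] at h
    · exact .inl (ih h)
    · exact .inr (ih h)
    · exact .inr (ih h)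

theorem subAt_append {A B : LPFormula} {p q : List SubStep} (h : A.subAt p = some B) :
    A.subAt (p ++ q) = B.subAt q := by
  induction p generalizing A with
  | nil =>
    rw [subAt_nil, Option.some.injEq] at h
    subst h
    rfl
  | cons a p ih =>
    cases A <;> cases a <;> simp only [subAt, reduceCtorEq] at h <;> exact ih h

theorem exists_just_of_forget_subAt {A : LPFormula} {B : S4Formula} {p : List SubStep}
    (h : A.forget.subAt p = some (.box B)) : ∃ t C, A.subAt p = some (.just t C) := by
  induction p generalizing A with
  | nil => cases A <;> simp_all [forget, S4Formula.subAt]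
  | cons a p ih =>
    cases A <;> cases a <;> simp only [forget, S4Formula.subAt, reduceCtorEq] at h <;> exact ih h

/-- Every justification term at an occurrence of polarity `b` in `A` may occur in the prehistory of
a `□` realized by `t`. -/
def Guarded (I : Set LPFormula) (b : Bool) (t : LPTerm) (A : LPFormula) : Prop :=
  ∀ p u B, A.subAt p = some (.just u B) → pathPolarity p = b → Inactive I u ∨ Below I u t

variable {I : Set LPFormula} {b : Bool} {s t : LPTerm} {A B : LPFormula}

theorem Guarded.mono (h : Guarded I b s A) (hs : s ∈ t.subterms) : Guarded I b t A :=
  fun p u B hp hb => (h p u B hp hb).imp_right fun h => h.mono hs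

/-- In (⊃ ·) this is used contrapositively: an unguarded `B` makes `A → B` unguarded, so nothing has
to be known about the vanishing formula `A`. -/
theorem Guarded.imp_right (h : Guarded I b t (.imp A B)) : Guarded I b t B :=
  fun p u C hp hb => h (.impRight :: p) u C hp hb

/-- The only new positive term is `t`, which the proper-subterm clause of `Below` admits under `!t`.
-/
theorem Guarded.bang (h : Guarded I true t A) : Guarded I true (.bang t) (.just t A) := by
  intro p u C hp hb
  have ht : t ∈ (LPTerm.bang t).subterms := .inl t.self_mem_subterms
  cases p with
  | nil =>
    simp only [subAt_nil, Option.some.injEq, just.injEq] at hp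
    rw [← hp.1]
    exact .inr (.inr ⟨ht, by simp⟩)
  | cons a p =>
    cases a <;> simp only [subAt, reduceCtorEq] at hp
    exact h.mono ht p u C hp hb

/-- The input `t:A` itself feeds every term of `A` to `t`. -/
theorem guarded_of_mem (h : just t A ∈ I) : Guarded I b t A :=
  fun _ _ _ hp _ => .inr (.inl ⟨t, A, h, t.self_mem_subterms, mem_subterms_of_subAt hp⟩)

/-- The outermost `t` has positive polarity in `t:A`, so it is exempt here and need not be below
itself. -/
theorem guarded_just_of_mem (h : just t A ∈ I) : Guarded I false t (.just t A) := by
  intro p u C hp hb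
  cases p with
  | nil => simp [pathPolarity] at hb
  | cons a p =>
    cases a <;> simp only [subAt, reduceCtorEq] at hp
    exact guarded_of_mem h p u C hp hb

end LPFormula

open LPFormula

/-! ## Annotated G3s-proofs -/

structure LPSequent : Type where
  ant : List LPFormula
  suc : List LPFormula

namespace LPSequent

def on (σ : LPSequent) : SeqSide → List LPFormula
  | .ant => σ.ant
  | .suc => σ.suc

def forget (σ : LPSequent) : S4Sequent := ⟨σ.ant.map LPFormula.forget, σ.suc.map LPFormula.forget⟩

theorem forget_on (σ : LPSequent) (s : SeqSide) :
    σ.forget.on s = (σ.on s).map LPFormula.forget := by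
  cases s <;> rfl

end LPSequent

/-- `Annotates I T σ`: the tree `T` is a G3s-proof of the projection of `σ` in which all `□` carry
justification terms, and in which (⊃ □) introduces only active terms and only from premises whose
positive terms are inactive or below the introduced one. -/
inductive Annotates (I : Set LPFormula) : G3sTree → LPSequent → Prop
  | ax (σ : LPSequent) (P : ℕ) : .atom P ∈ σ.ant → .atom P ∈ σ.suc → Annotates I (.ax σ.forget) σ
  | botL (σ : LPSequent) : .bot ∈ σ.ant → Annotates I (.botL σ.forget) σ
  | impL (σ : LPSequent) (i : ℕ) (A B : LPFormula) (T₁ T₂ : G3sTree) :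
      σ.ant[i]? = some (.imp A B) → Annotates I T₁ ⟨σ.ant.eraseIdx i, A :: σ.suc⟩ →
      Annotates I T₂ ⟨B :: σ.ant.eraseIdx i, σ.suc⟩ → Annotates I (.impL σ.forget i T₁ T₂) σ
  | impR (σ : LPSequent) (i : ℕ) (A B : LPFormula) (T : G3sTree) :
      σ.suc[i]? = some (.imp A B) → Annotates I T ⟨A :: σ.ant, B :: σ.suc.eraseIdx i⟩ →
      Annotates I (.impR σ.forget i T) σ
  | boxL (σ : LPSequent) (i : ℕ) (t : LPTerm) (A : LPFormula) (T : G3sTree) :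
      σ.ant[i]? = some (.just t A) → Annotates I T ⟨A :: σ.ant, σ.suc⟩ →
      Annotates I (.boxL σ.forget i T) σ
  | boxR (σ : LPSequent) (i : ℕ) (ks : List ℕ) (t : LPTerm) (A : LPFormula) (G : List LPFormula)
      (T : G3sTree) :
      σ.suc[i]? = some (.just t A) → ks.Nodup → ks.map (fun k => σ.ant[k]?) = G.map some →
      (∀ C ∈ G, (∃ s B, C = .just s B) ∧ Guarded I false t C) → Guarded I true t A →
      ¬ Inactive I t → Annotates I T ⟨G, [A]⟩ → Annotates I (.boxR σ.forget i ks T) σ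

namespace Annotates

variable {I : Set LPFormula} {T : G3sTree} {σ : LPSequent}

theorem root_eq (h : Annotates I T σ) : T.root = σ.forget := by
  cases h <;> rfl

theorem correct (h : Annotates I T σ) : T.Correct := by
  induction h with
  | ax σ P h₁ h₂ => exact ⟨P, List.mem_map_of_mem h₁, List.mem_map_of_mem h₂⟩
  | botL σ h => exact List.mem_map_of_mem (f := LPFormula.forget) h
  | impL σ i A B T₁ T₂ hi h₁ h₂ ih₁ ih₂ =>
    refine ⟨A.forget, B.forget, by simp [LPSequent.forget, hi, LPFormula.forget], ?_, ?_, ih₁, ih₂⟩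
    · simp [h₁.root_eq, LPSequent.forget, List.eraseIdx_map]
    · simp [h₂.root_eq, LPSequent.forget, List.eraseIdx_map]
  | impR σ i A B T hi h ih =>
    refine ⟨A.forget, B.forget, by simp [LPSequent.forget, hi, LPFormula.forget], ?_, ih⟩
    simp [h.root_eq, LPSequent.forget, List.eraseIdx_map]
  | boxL σ i t A T hi h ih =>
    refine ⟨A.forget, by simp [LPSequent.forget, hi, LPFormula.forget], ?_, ih⟩
    simp [h.root_eq, LPSequent.forget]
  | boxR σ i ks t A G T hi hks hG hs hA ht h ih =>
    have hunbox : ∃ G' : List S4Formula, G.map LPFormula.forget = G'.map .box := by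
      clear hG h ih
      induction G with
      | nil => exact ⟨[], rfl⟩
      | cons C G ihG =>
        obtain ⟨G', hG'⟩ := ihG fun D hD => hs D (List.mem_cons_of_mem _ hD)
        obtain ⟨⟨s, B, rfl⟩, -⟩ := hs C List.mem_cons_self
        exact ⟨B.forget :: G', by simp [hG', LPFormula.forget]⟩
    obtain ⟨G', hG'⟩ := hunbox
    refine ⟨A.forget, G', by simp [LPSequent.forget, hi, LPFormula.forget], hks, ?_, ?_, ih⟩
    · have := congrArg (List.map (Option.map LPFormula.forget)) hG
      have h2 := congrArg (List.map some) hG'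
      simp only [List.map_map, Function.comp_def, Option.map_some] at this h2 ⊢
      simpa [LPSequent.forget, h2] using this
    · simp [h.root_eq, LPSequent.forget, hG']

end Annotates

/-! ### Annotations of all nodes of a proof tree -/

/-- The polarity of the formulas on one side of a sequent. -/
def SeqSide.polarity : SeqSide → Bool
  | .ant => false
  | .suc => true

theorem ProofOcc.positive_iff (o : ProofOcc) : o.Positive ↔ pathPolarity o.path = o.side.polarity := by
  obtain ⟨a, s, i, p⟩ := o
  cases s <;> rfl

/-- The annotation `σ` of a node `U` fits the annotations `τ` of its premises. -/
structure LocallyAnnotated (I : Set LPFormula) (U : G3sTree) (σ : LPSequent)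
    (τ : Bool → LPSequent) : Prop where
  root_eq : U.root = σ.forget
  origin : ∀ b s j s' j' p (F : LPFormula), U.origin b s j = some (s', j', p) → ((τ b).on s)[j]? = some F →
    ∃ F', (σ.on s')[j']? = some F' ∧ F'.subAt p = some F
  boxR : ∀ S i ks V, U = .boxR S i ks V → ∃ t A, σ.suc[i]? = some (.just t A) ∧ ¬ Inactive I t ∧
    ∀ (s : SeqSide) (j : ℕ) (F : LPFormula) p u B, ((τ false).on s)[j]? = some F → F.subAt p = some (.just u B) →
      pathPolarity p = s.polarity → Inactive I u ∨ Below I u t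

theorem getElem?_skipIdx {α : Type*} (l : List α) (i j : ℕ) :
    l[G3sTree.skipIdx i j]? = (l.eraseIdx i)[j]? := by
  rw [List.getElem?_eraseIdx, G3sTree.skipIdx]
  split <;> rfl

/-- `N` annotates the nodes of `T`. -/
def IsAnnotation (I : Set LPFormula) (T : G3sTree) (N : List Bool → LPSequent) : Prop :=
  ∀ a U, T.subtree a = some U → LocallyAnnotated I U (N a) fun b => N (a ++ [b])

/-- Annotations of the premises are glued along the first step of the path. -/
theorem exists_annotation_of_children {I : Set LPFormula} {T : G3sTree} {σ : LPSequent}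
    (N : Bool → List Bool → LPSequent) (hroot : LocallyAnnotated I T σ fun b => N b [])
    (hch : ∀ b a U, T.subtree (b :: a) = some U →
      LocallyAnnotated I U (N b a) fun b' => N b (a ++ [b'])) :
    ∃ N : List Bool → LPSequent, N [] = σ ∧ IsAnnotation I T N := by
  refine ⟨fun | [] => σ | b :: a => N b a, rfl, ?_⟩
  rintro (_ | ⟨b, a⟩) U h
  · obtain rfl : T = U := by simpa [G3sTree.subtree] using h
    exact hroot
  · exact hch b a U h

theorem Annotates.exists_annotation {I : Set LPFormula} {T : G3sTree} {σ : LPSequent}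
    (h : Annotates I T σ) : ∃ N : List Bool → LPSequent, N [] = σ ∧ IsAnnotation I T N := by
  induction h with
  | ax σ P _ _ =>
    refine exists_annotation_of_children (fun _ _ => σ) ⟨rfl, ?_, ?_⟩ ?_
    · intro b s j s' j' p F hb; simp [G3sTree.origin] at hb
    · intro S i ks V hV; simp at hV
    · intro b a U hU; simp [G3sTree.subtree] at hU
  | botL σ _ =>
    refine exists_annotation_of_children (fun _ _ => σ) ⟨rfl, ?_, ?_⟩ ?_
    · intro b s j s' j' p F hb; simp [G3sTree.origin] at hb
    · intro S i ks V hV; simp at hV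
    · intro b a U hU; simp [G3sTree.subtree] at hU
  | impL σ i A B T₁ T₂ hi h₁ h₂ ih₁ ih₂ =>
    obtain ⟨N₁, e₁, H₁⟩ := ih₁
    obtain ⟨N₂, e₂, H₂⟩ := ih₂
    refine exists_annotation_of_children (fun b => bif b then N₂ else N₁) ⟨rfl, ?_, ?_⟩ ?_
    · rintro (_ | _) (_ | _) (_ | j) s' j' p F hb hF <;>
        simp only [G3sTree.origin, Option.some.injEq, Prod.mk.injEq] at hb <;>
        obtain ⟨rfl, rfl, rfl⟩ := hb <;>
        simp_all [LPSequent.on, LPFormula.subAt, getElem?_skipIdx]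
    · intro S i ks V hV; simp at hV
    · rintro (_ | _) a U hU
      · exact H₁ a U hU
      · exact H₂ a U hU
  | impR σ i A B T hi h ih =>
    obtain ⟨N, e, H⟩ := ih
    refine exists_annotation_of_children (fun _ => N) ⟨rfl, ?_, ?_⟩ ?_
    · rintro (_ | _) (_ | _) (_ | j) s' j' p F hb hF <;>
        simp only [G3sTree.origin, Option.some.injEq, Prod.mk.injEq, reduceCtorEq] at hb <;>
        obtain ⟨rfl, rfl, rfl⟩ := hb <;>
        simp_all [LPSequent.on, LPFormula.subAt, getElem?_skipIdx]
    · intro S i ks V hV; simp at hV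
    · rintro (_ | _) a U hU
      · exact H a U hU
      · simp [G3sTree.subtree] at hU
  | boxL σ i t A T hi h ih =>
    obtain ⟨N, e, H⟩ := ih
    refine exists_annotation_of_children (fun _ => N) ⟨rfl, ?_, ?_⟩ ?_
    · rintro (_ | _) (_ | _) (_ | j) s' j' p F hb hF <;>
        simp only [G3sTree.origin, Option.some.injEq, Prod.mk.injEq, reduceCtorEq] at hb <;>
        obtain ⟨rfl, rfl, rfl⟩ := hb <;>
        simp_all [LPSequent.on, LPFormula.subAt]
    · intro S i ks V hV; simp at hV
    · rintro (_ | _) a U hU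
      · exact H a U hU
      · simp [G3sTree.subtree] at hU
  | boxR σ i ks t A G T hi hks hG hs hA ht h ih =>
    obtain ⟨N, e, H⟩ := ih
    refine exists_annotation_of_children (fun _ => N) ⟨rfl, ?_, ?_⟩ ?_
    · rintro (_ | _) (_ | _) j s' j' p F hb hF
      · simp only [G3sTree.origin, Option.map_eq_some_iff, Prod.mk.injEq] at hb
        obtain ⟨k, hk, rfl, rfl, rfl⟩ := hb
        have := congrArg (fun l => l[j]?) hG
        simp only [e, LPSequent.on] at hF
        simp only [List.getElem?_map, hk, hF, Option.map_some, Option.some.injEq] at this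
        exact ⟨F, this, subAt_nil F⟩
      · rcases j with _ | j <;>
          simp only [G3sTree.origin, Option.some.injEq, Prod.mk.injEq, reduceCtorEq] at hb
        obtain ⟨rfl, rfl, rfl⟩ := hb
        simp_all [LPSequent.on, LPFormula.subAt]
      · simp [G3sTree.origin] at hb
      · simp [G3sTree.origin] at hb
    · rintro S i' ks' V hV
      simp only [G3sTree.boxR.injEq] at hV
      obtain ⟨-, rfl, -, -⟩ := hV
      refine ⟨t, A, hi, ht, ?_⟩
      rintro (_ | _) j F p u B hF hp hpol
      · simp only [e, LPSequent.on] at hF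
        exact (hs F (List.mem_of_getElem? hF)).2 p u B hp hpol
      · simp only [e, LPSequent.on] at hF
        obtain rfl : F = A := List.mem_singleton.1 (List.mem_of_getElem? hF)
        exact hA p u B hp hpol
    · rintro (_ | _) a U hU
      · exact H a U hU
      · simp [G3sTree.subtree] at hU

/-! ## Annotated proofs have no prehistoric cycles -/

/-- The justification term at an occurrence. -/
def occTerm (N : List Bool → LPSequent) (o : ProofOcc) : Option LPTerm :=
  match (((N o.node).on o.side)[o.pos]?).bind fun F => F.subAt o.path with
  | some (.just t _) => some t
  | _ => none

theorem occTerm_eq {N : List Bool → LPSequent} {o : ProofOcc} {F : LPFormula}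
    (h : ((N o.node).on o.side)[o.pos]? = some F) {t : LPTerm} {B : LPFormula}
    (hF : F.subAt o.path = some (.just t B)) : occTerm N o = some t := by
  simp [occTerm, h, hF]

section Cycles

variable {I : Set LPFormula} {T : G3sTree} {N : List Bool → LPSequent}

theorem exists_formula_of_boxOcc (hN : IsAnnotation I T N) (x : T.BoxOcc) : ∃ F t B,
    ((N x.1.node).on x.1.side)[x.1.pos]? = some F ∧ F.subAt x.1.path = some (.just t B) := by
  obtain ⟨o, U, F, B, hU, hF, hB⟩ := x
  rw [(hN _ _ hU).root_eq, LPSequent.forget_on, List.getElem?_map, Option.map_eq_some_iff] at hF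
  obtain ⟨F', hF', rfl⟩ := hF
  obtain ⟨t, C, h⟩ := exists_just_of_forget_subAt hB
  exact ⟨F', t, C, hF', h⟩

/-- This lets the term of an occurrence descend to families. -/
theorem occTerm_eq_of_directCorr (hN : IsAnnotation I T N) (x y : T.BoxOcc)
    (h : T.DirectCorr x y) :
    occTerm N x.1 = occTerm N y.1 := by
  obtain ⟨U, b, p, hU, hnode, horigin, hpath⟩ := h
  obtain ⟨F, t, B, hF, hB⟩ := exists_formula_of_boxOcc hN x
  rw [occTerm_eq hF hB]
  rw [hnode] at hF
  obtain ⟨F', hF', hp⟩ := (hN _ _ hU).origin _ _ _ _ _ _ _ horigin hF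
  refine (occTerm_eq hF' (B := B) ?_).symm
  rw [hpath, subAt_append hp, hB]

theorem exists_below_of_introducedAt (hN : IsAnnotation I T N) {a : List Bool} {x : T.BoxOcc}
    (h : T.IntroducedAt a x) :
    ∃ t, occTerm N x.1 = some t ∧ ¬ Inactive I t ∧ ∀ y : T.BoxOcc, y.1.node = a ++ [false] →
      y.1.Positive → ∀ u, occTerm N y.1 = some u → Inactive I u ∨ Below I u t := by
  obtain ⟨S, i, ks, V, hU, hx⟩ := h
  obtain ⟨t, A, hA, ht, hbelow⟩ := (hN _ _ hU).boxR _ _ _ _ rfl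
  refine ⟨t, ?_, ht, ?_⟩
  · rw [hx]
    exact occTerm_eq (o := ⟨a, .suc, i, []⟩) (F := .just t A) (B := A) hA (subAt_nil _)
  · intro y hy hpos u hu
    obtain ⟨F, u', B, hF, hB⟩ := exists_formula_of_boxOcc hN y
    rw [occTerm_eq hF hB, Option.some.injEq] at hu
    subst hu
    rw [hy] at hF
    exact hbelow _ _ _ _ _ _ hF hB ((ProofOcc.positive_iff _).1 hpos)

/-- Being principal, `h` is introduced somewhere, which makes its term active, and all its
occurrences are positive. The guard at the rule introducing `f` therefore applies to the occurrence
in the premise, and its inactive alternative is excluded. -/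
theorem exists_below_of_prehistoric (hN : IsAnnotation I T N) {h f : T.Family}
    (hhf : T.Prehistoric h f) :
    ∃ u t, Quot.lift (fun x : T.BoxOcc => occTerm N x.1) (occTerm_eq_of_directCorr hN) h = some u ∧
      Quot.lift (fun x : T.BoxOcc => occTerm N x.1) (occTerm_eq_of_directCorr hN) f = some t ∧
      Below I u t := by
  obtain ⟨s, ⟨hpos, a', z, hz, hzh⟩, -, a, x, y, hx, rfl, hya, -, rfl⟩ :
      ∃ s, T.PrehistoricOn s h f := hhf.elim (fun h => ⟨_, h⟩) (fun h => ⟨_, h⟩)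
  obtain ⟨t, ht, -, hbelow⟩ := exists_below_of_introducedAt hN hx
  obtain ⟨u, hu, hact, -⟩ := exists_below_of_introducedAt hN hz
  have huy : occTerm N y.1 = some u := by
    rw [← hu]
    exact (congrArg (Quot.lift (fun x : T.BoxOcc => occTerm N x.1)
      (occTerm_eq_of_directCorr hN)) hzh).symm
  exact ⟨u, t, huy, ht, (hbelow y hya (hpos y rfl) u huy).resolve_left hact⟩

theorem selfReferential_of_hasPrehistoricCycle (hN : IsAnnotation I T N)
    (h : T.HasPrehistoricCycle) :
    SelfReferential I := by
  obtain ⟨n, hn, p, hp⟩ := h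
  set L := Quot.lift (fun x : T.BoxOcc => occTerm N x.1) (occTerm_eq_of_directCorr hN)
  -- The default is never taken on the cycle: families related by `≺` have a term.
  refine selfReferential_of_transGen_below (t := (L (p 0)).getD (.const 0))
    (transGen_of_cycle (p := fun k => (L (p k)).getD (.const 0)) hn fun k hk => ?_)
  obtain ⟨u, t, hu, ht, hut⟩ := exists_below_of_prehistoric hN (hp k hk)
  simp only [L, hu, ht, Option.getD_some]
  exact hut

end Cycles

/-! ## Saturation -/

/-- Derivability in the annotated calculus. -/
def Derivable (I : Set LPFormula) (σ : LPSequent) : Prop := ∃ T, Annotates I T σ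

/-- Selects the side formulas of (⊃ □) together with their positions. -/
theorem exists_sublist_positions {α : Type*} (P : α → Prop) (l : List α) :
    ∃ (L : List α) (ks : List ℕ), ks.Nodup ∧ ks.map (fun k => l[k]?) = L.map some ∧
      ∀ a, a ∈ L ↔ a ∈ l ∧ P a := by
  induction l with
  | nil => exact ⟨[], [], by simp⟩
  | cons a l ih =>
    obtain ⟨L, ks, hks, h, hL⟩ := ih
    by_cases ha : P a
    · refine ⟨a :: L, 0 :: ks.map Nat.succ, ?_, ?_, ?_⟩
      · simpa using hks.map Nat.succ_injective
      · simpa [Function.comp_def] using h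
      · intro b
        rw [List.mem_cons, List.mem_cons, hL]
        constructor
        · rintro (rfl | h)
          · exact ⟨.inl rfl, ha⟩
          · exact ⟨.inr h.1, h.2⟩
        · rintro ⟨h | h, hb⟩
          · exact .inl h
          · exact .inr ⟨h, hb⟩
    · refine ⟨L, ks.map Nat.succ, hks.map Nat.succ_injective, ?_, ?_⟩
      · simpa [Function.comp_def] using h
      · intro b
        rw [List.mem_cons, hL]
        refine and_congr_left fun hb => ⟨.inr, ?_⟩
        rintro (rfl | h)
        · exact absurd hb ha
        · exact h

theorem exists_eraseIdx_perm {α : Type*} {a : α} {l l' : List α} (h : l.Perm (a :: l')) :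
    ∃ i, l[i]? = some a ∧ (l.eraseIdx i).Perm l' := by
  obtain ⟨i, hi⟩ := List.mem_iff_getElem?.1 (h.mem_iff.2 List.mem_cons_self)
  obtain ⟨hlt, hi'⟩ := List.getElem?_eq_some_iff.1 hi
  refine ⟨i, hi, (List.perm_cons a).1 (List.Perm.trans ?_ h)⟩
  rw [← hi']
  exact List.getElem_cons_eraseIdx_perm hlt

/-- A pair of sets that behaves like the true and the false formulas of a world, except that the
reflexivity of `□` is not required for formulas in `E`. -/
structure Saturated (I : Set LPFormula) (E : Set LPFormula) (G D : Set LPFormula) : Prop where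
  bot : .bot ∉ G
  atom : ∀ P, .atom P ∈ G → .atom P ∉ D
  impL : ∀ A B, .imp A B ∈ G → A ∈ D ∨ B ∈ G
  impR : ∀ A B, .imp A B ∈ D → A ∈ G ∧ B ∈ D
  boxL : ∀ t A, .just t A ∈ G → A ∈ G ∨ .just t A ∈ E
  boxR : ∀ t A, .just t A ∈ D → ¬ Inactive I t → Guarded I true t A →
    ∃ L : List LPFormula, (∀ s B, .just s B ∈ G → Guarded I false t (.just s B) → .just s B ∈ L) ∧
      ¬ Derivable I ⟨L, [A]⟩

/-- For `boxR`, `L` consists of all justification formulas of `Γ` that the guard admits; a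
derivation of `L ⊃ A` would extend by (⊃ □), with everything else as weakening formulas. The
reflexivity condition is void because all of `Γ` is exempt. -/
theorem saturated_of_not_derivable {I : Set LPFormula} {Γ Δ : List LPFormula}
    (h : ¬ Derivable I ⟨Γ, Δ⟩) (hΓ : ∀ A B, .imp A B ∉ Γ) (hΔ : ∀ A B, .imp A B ∉ Δ) :
    Saturated I {A | A ∈ Γ} {A | A ∈ Γ} {A | A ∈ Δ} where
  bot hb := h ⟨_, .botL _ hb⟩
  atom P h₁ h₂ := h ⟨_, .ax _ P h₁ h₂⟩
  impL A B hAB := absurd hAB (hΓ A B)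
  impR A B hAB := absurd hAB (hΔ A B)
  boxL t A hA := .inr hA
  boxR t A hA ht hg := by
    obtain ⟨L, ks, hks, hmap, hL⟩ := exists_sublist_positions
      (fun C => (∃ s B, C = LPFormula.just s B) ∧ Guarded I false t C) Γ
    refine ⟨L, fun s B hB hgB => (hL _).2 ⟨hB, ⟨s, B, rfl⟩, hgB⟩, ?_⟩
    rintro ⟨T, hT⟩
    obtain ⟨i, hi⟩ := List.mem_iff_getElem?.1 hA
    exact h ⟨_, .boxR _ i ks t A L T hi hks hmap (fun C hC => ((hL C).1 hC).2) hg ht hT⟩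

/-- The number of symbols of a formula, terms not counted. -/
def LPFormula.size : LPFormula → ℕ
  | .bot => 1
  | .atom _ => 1
  | .imp A B => A.size + B.size + 1
  | .just _ A => A.size + 1

/-- `Γ`, `Δ` are still to be decomposed, `Θ`, `Λ` are finished, and the actual sequent is their
union up to order. The induction is on the size of the pending part: under (□ ⊃) the formula `t:A`
moves to `Θ` and only `A` becomes pending, so keeping the principal formula does not spoil
termination. -/
theorem exists_saturated_aux {I : Set LPFormula} (n : ℕ) : ∀ Γ Θ Δ Λ Γ' Δ' : List LPFormula,
    (Γ.map LPFormula.size).sum + (Δ.map LPFormula.size).sum = n →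
    Γ'.Perm (Γ ++ Θ) → Δ'.Perm (Δ ++ Λ) → (∀ A B, .imp A B ∉ Θ) → (∀ A B, .imp A B ∉ Λ) →
    ¬ Derivable I ⟨Γ', Δ'⟩ →
    ∃ G D, Saturated I {A | A ∈ Θ} G D ∧ (∀ A ∈ Γ', A ∈ G) ∧ ∀ A ∈ Δ', A ∈ D := by
  induction n using Nat.strong_induction_on with
  | _ n ih =>
  intro Γ Θ Δ Λ Γ' Δ' hn hΓ hΔ hΘ hΛ hd
  match Γ, Δ with
  | [], [] =>
    have hs := saturated_of_not_derivable hd (fun A B h => hΘ A B (hΓ.mem_iff.1 h))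
      (fun A B h => hΛ A B (hΔ.mem_iff.1 h))
    refine ⟨{A | A ∈ Γ'}, {A | A ∈ Δ'}, ?_, fun _ h => h, fun _ h => h⟩
    have : {A | A ∈ Γ'} = {A | A ∈ Θ} := Set.ext fun A => hΓ.mem_iff
    rwa [this] at hs ⊢
  | .bot :: Γ, Δ =>
    exact absurd ⟨_, .botL _ (hΓ.mem_iff.2 List.mem_cons_self)⟩ hd
  | .atom P :: Γ, Δ =>
    obtain ⟨G, D, hs, hG, hD⟩ := ih _ (by simp [← hn, LPFormula.size]) Γ (.atom P :: Θ) Δ Λ Γ' Δ' rfl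
      (hΓ.trans List.perm_middle.symm) hΔ (by simpa using hΘ) hΛ hd
    refine ⟨G, D, { hs with boxL := fun t A h => ?_ }, hG, hD⟩
    simpa using hs.boxL t A h
  | .just t A :: Γ, Δ =>
    obtain ⟨i, hi, -⟩ := exists_eraseIdx_perm hΓ
    obtain ⟨G, D, hs, hG, hD⟩ := ih _ (by simp [← hn, LPFormula.size]) (A :: Γ) (.just t A :: Θ) Δ Λ
      (A :: Γ') Δ' rfl ((hΓ.trans List.perm_middle.symm).cons A) hΔ (by simpa using hΘ) hΛ
      fun ⟨T, hT⟩ => hd ⟨_, .boxL _ i t A T hi hT⟩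
    refine ⟨G, D, { hs with boxL := fun s B h => ?_ }, fun B hB => hG B (.tail _ hB), hD⟩
    -- `t:A` can leave the exempt set, since its body has been added to the antecedent.
    rcases hs.boxL s B h with h | h
    · exact .inl h
    · rcases List.mem_cons.1 h with h | h
      · cases h
        exact .inl (hG A List.mem_cons_self)
      · exact .inr h
  | .imp A B :: Γ, Δ =>
    obtain ⟨i, hi, hp⟩ := exists_eraseIdx_perm hΓ
    have : ¬ Derivable I ⟨Γ'.eraseIdx i, A :: Δ'⟩ ∨ ¬ Derivable I ⟨B :: Γ'.eraseIdx i, Δ'⟩ := by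
      by_contra! hc
      obtain ⟨⟨T₁, h₁⟩, T₂, h₂⟩ := hc
      exact hd ⟨_, .impL _ i A B T₁ T₂ hi h₁ h₂⟩
    have hmem : ∀ C ∈ Γ', C = .imp A B ∨ C ∈ Γ'.eraseIdx i := by
      intro C hC
      simpa [hp.mem_iff] using hΓ.mem_iff.1 hC
    rcases this with h | h
    · obtain ⟨G, D, hs, hG, hD⟩ := ih _ (by simp [← hn, LPFormula.size]; omega) Γ Θ (A :: Δ) Λ
        _ _ rfl hp (hΔ.cons A) hΘ hΛ h
      -- The rule consumed `A → B`, so it is put back; the box conditions concern justification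
      -- formulas only and are unaffected.
      refine ⟨insert (.imp A B) G, D, ?_, ?_, fun C hC => hD C (.tail _ hC)⟩
      · refine ⟨by simpa using hs.bot, by simpa using hs.atom, ?_, ?_, ?_, by simpa using hs.boxR⟩
        · rintro A' B' (h | h)
          · cases h
            exact .inl (hD A List.mem_cons_self)
          · exact (hs.impL _ _ h).imp_right .inr
        · exact fun A' B' h => (hs.impR _ _ h).imp_left .inr
        · rintro t C (h | h)
          · cases h
          · exact (hs.boxL _ _ h).imp_left .inr
      · exact fun C hC => (hmem C hC).imp_right (hG C)
    · obtain ⟨G, D, hs, hG, hD⟩ := ih _ (by simp [← hn, LPFormula.size]) (B :: Γ) Θ Δ Λ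
        _ _ rfl (hp.cons B) hΔ hΘ hΛ h
      refine ⟨insert (.imp A B) G, D, ?_, ?_, hD⟩
      · refine ⟨by simpa using hs.bot, by simpa using hs.atom, ?_, ?_, ?_, by simpa using hs.boxR⟩
        · rintro A' B' (h | h)
          · cases h
            exact .inr (.inr (hG B List.mem_cons_self))
          · exact (hs.impL _ _ h).imp_right .inr
        · exact fun A' B' h => (hs.impR _ _ h).imp_left .inr
        · rintro t C (h | h)
          · cases h
          · exact (hs.boxL _ _ h).imp_left .inr
      · exact fun C hC => (hmem C hC).imp_right fun h => hG C (.tail _ h)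
  | [], .imp A B :: Δ =>
    obtain ⟨i, hi, hp⟩ := exists_eraseIdx_perm hΔ
    obtain ⟨G, D, hs, hG, hD⟩ := ih _ (by simp [← hn, LPFormula.size]; omega) [A] Θ (B :: Δ) Λ
      (A :: Γ') (B :: Δ'.eraseIdx i) rfl (hΓ.cons A) (hp.cons B) hΘ hΛ
      fun ⟨T, hT⟩ => hd ⟨_, .impR _ i A B T hi hT⟩
    have hmem : ∀ C ∈ Δ', C = .imp A B ∨ C ∈ Δ'.eraseIdx i := by
      intro C hC
      simpa [hp.mem_iff] using hΔ.mem_iff.1 hC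
    refine ⟨G, insert (.imp A B) D, ?_, fun C hC => hG C (.tail _ hC),
      fun C hC => (hmem C hC).imp_right fun h => hD C (.tail _ h)⟩
    refine ⟨hs.bot, by simpa using hs.atom, ?_, ?_, hs.boxL, by simpa using hs.boxR⟩
    · exact fun A' B' h => (hs.impL _ _ h).imp_left .inr
    · rintro A' B' (h | h)
      · cases h
        exact ⟨hG A List.mem_cons_self, .inr (hD B List.mem_cons_self)⟩
      · exact (hs.impR _ _ h).imp_right .inr
  | [], .bot :: Δ =>
    exact ih _ (by simp [← hn, LPFormula.size]) [] Θ Δ (.bot :: Λ) Γ' Δ' rfl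
      hΓ (hΔ.trans List.perm_middle.symm) hΘ (by simpa using hΛ) hd
  | [], .atom P :: Δ =>
    exact ih _ (by simp [← hn, LPFormula.size]) [] Θ Δ (.atom P :: Λ) Γ' Δ' rfl
      hΓ (hΔ.trans List.perm_middle.symm) hΘ (by simpa using hΛ) hd
  | [], .just t A :: Δ =>
    exact ih _ (by simp [← hn, LPFormula.size]) [] Θ Δ (.just t A :: Λ) Γ' Δ' rfl
      hΓ (hΔ.trans List.perm_middle.symm) hΘ (by simpa using hΛ) hd

/-! ## The model of saturated pairs -/

structure World (I : Set LPFormula) : Type where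
  G : Set LPFormula
  D : Set LPFormula
  saturated : Saturated I ∅ G D

theorem exists_world {I : Set LPFormula} {Γ Δ : List LPFormula} (h : ¬ Derivable I ⟨Γ, Δ⟩) :
    ∃ w : World I, (∀ A ∈ Γ, A ∈ w.G) ∧ ∀ A ∈ Δ, A ∈ w.D := by
  obtain ⟨G, D, hs, hG, hD⟩ := exists_saturated_aux _ Γ [] Δ [] Γ Δ rfl (by simp) (by simp)
    (by simp) (by simp) h
  exact ⟨⟨G, D, by simpa using hs⟩, hG, hD⟩

namespace World

variable {I : Set LPFormula}

/-- Accessibility with respect to a term. -/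
def Acc (t : LPTerm) (w v : World I) : Prop :=
  ∀ s B, .just s B ∈ w.G → Guarded I false t (.just s B) → .just s B ∈ v.G

theorem acc_refl (t : LPTerm) (w : World I) : Acc t w w := fun _ _ h _ => h

theorem Acc.trans {t : LPTerm} {u v w : World I} (h₁ : Acc t u v) (h₂ : Acc t v w) : Acc t u w :=
  fun s B h hg => h₂ s B (h₁ s B h hg) hg

theorem Acc.of_subterm {s t : LPTerm} {v w : World I} (h : Acc t v w) (hs : s ∈ t.subterms) :
    Acc s v w :=
  fun r B hB hg => h r B hB (hg.mono hs)

/-- The conditions under which a formula is true (first component) and false (second component) at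
a world. Every formula is true or false; formulas `t:A` may be both. -/
def val : LPFormula → World I → Prop × Prop
  | .bot, _ => (False, True)
  | .atom P, w => (.atom P ∈ w.G, .atom P ∉ w.G)
  | .imp A B, w => ((val A w).2 ∨ (val B w).1, (val A w).1 ∧ (val B w).2)
  | .just t A, w =>
    (.just t A ∈ w.G ∨
      ¬ (Inactive I t ∨ ¬ Guarded I true t A ∨ ∃ v, Acc t w v ∧ (val A v).2),
    Inactive I t ∨ ¬ Guarded I true t A ∨ ∃ v, Acc t w v ∧ (val A v).2)

theorem val_total (A : LPFormula) (w : World I) : (val A w).1 ∨ (val A w).2 := by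
  induction A with
  | bot => exact .inr trivial
  | atom P => exact em _
  | imp A B ihA ihB => simp only [val]; tauto
  | just t A _ => simp only [val]; tauto

/-- Truth lemma. For `t:A` on the false side, saturation supplies an underivable `L ⊃ A`, and the
world extending it is accessible because `L` contains all guarded justification formulas of `w.G`.
-/
theorem val_of_mem (A : LPFormula) :
    ∀ w : World I, (A ∈ w.G → (val A w).1) ∧ (A ∈ w.D → (val A w).2) := by
  induction A with
  | bot => exact fun w => ⟨w.saturated.bot, fun _ => trivial⟩
  | atom P => exact fun w => ⟨id, fun h h' => w.saturated.atom P h' h⟩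
  | imp A B ihA ihB =>
    refine fun w => ⟨fun h => ?_, fun h => ?_⟩
    · exact (w.saturated.impL A B h).imp (ihA w).2 (ihB w).1
    · exact (w.saturated.impR A B h).imp (ihA w).1 (ihB w).2
  | just t A ih =>
    refine fun w => ⟨.inl, fun h => ?_⟩
    by_cases ht : Inactive I t
    · exact .inl ht
    by_cases hg : Guarded I true t A
    · obtain ⟨L, hL, hd⟩ := w.saturated.boxR t A h ht hg
      obtain ⟨v, hv, hA⟩ := exists_world hd
      exact .inr (.inr ⟨v, fun s B hB hgB => hv _ (hL s B hB hgB), (ih v).2 (hA A (by simp))⟩)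
    · exact .inr (.inl hg)

/-! ### Semantic counterparts of the rules of G3lp -/

theorem val_of_val_just {t : LPTerm} {A : LPFormula} {w : World I}
    (h : (val (.just t A) w).1) : (val A w).1 := by
  rcases h with h | h
  · exact (val_of_mem A w).1 ((w.saturated.boxL t A h).resolve_right id)
  · push Not at h
    -- Falsity of `A` at `w` would, by reflexivity, make `w` a witness against `t:A`.
    exact (val_total A w).resolve_right (h.2.2 w (acc_refl t w))

theorem val_subterm {s t : LPTerm} {A : LPFormula} {w : World I} (hs : s ∈ t.subterms)
    (h : (val (.just t A) w).2) : (val (.just s A) w).2 := by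
  rcases h with h | h | ⟨v, hv, hA⟩
  · exact .inl (h.of_subterm hs)
  · exact .inr (.inl fun hg => h (hg.mono hs))
  · exact .inr (.inr ⟨v, hv.of_subterm hs, hA⟩)

/-- At a world refuting `B`, totality decides `A`: if true, the world refutes `A → B`; if false, it
refutes `A`. -/
theorem val_app {s t : LPTerm} {B : LPFormula} {w : World I}
    (h : (val (.just (.app s t) B) w).2) (A : LPFormula) :
    (val (.just s (.imp A B)) w).2 ∨ (val (.just t A) w).2 := by
  have hs : s ∈ (LPTerm.app s t).subterms := .inl (.inl s.self_mem_subterms)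
  have ht : t ∈ (LPTerm.app s t).subterms := .inl (.inr t.self_mem_subterms)
  rcases h with h | h | ⟨v, hv, hB⟩
  · exact .inl (.inl (h.of_subterm hs))
  · exact .inl (.inr (.inl fun hg => h (hg.imp_right.mono hs)))
  · rcases val_total A v with hA | hA
    · exact .inl (.inr (.inr ⟨v, hv.of_subterm hs, hA, hB⟩))
    · exact .inr (.inr (.inr ⟨v, hv.of_subterm ht, hA⟩))

/-- Transitivity of accessibility merges the two witnesses. -/
theorem val_bang {t : LPTerm} {A : LPFormula} {w : World I}
    (h : (val (.just (.bang t) (.just t A)) w).2) : (val (.just t A) w).2 := by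
  have ht : t ∈ (LPTerm.bang t).subterms := .inl t.self_mem_subterms
  rcases h with h | h | ⟨v, hv, h | h | ⟨u, hu, hA⟩⟩
  · exact .inl (h.of_subterm ht)
  · exact .inr (.inl fun hg => h hg.bang)
  · exact .inl h
  · exact .inr (.inl h)
  · exact .inr (.inr ⟨u, (hv.of_subterm ht).trans hu, hA⟩)

/-- An input is active and guarded by itself, so only a genuine counterexample world can make it
false. -/
theorem exists_acc_of_input {t : LPTerm} {A : LPFormula} {w : World I}
    (hI : .just t A ∈ I) (h : (val (.just t A) w).2) : ∃ v, Acc t w v ∧ (val A v).2 := by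
  rcases h with h | h | h
  · exact absurd hI (h t t.self_mem_subterms A)
  · exact absurd (guarded_of_mem hI) h
  · exact h

/-- Soundness of G3lp. -/
theorem sound {X : Set PropScheme} {Γ Δ : Multiset LPFormula} (d : G3lp X Γ Δ) :
    d.inputs ⊆ I → ∀ w : World I, (∀ A ∈ Γ, (val A w).1) → (∀ A ∈ Δ, (val A w).2) → False := by
  induction d with
  | ax Γ Δ P =>
    intro _ w hΓ hΔ
    exact hΔ (.atom P) (Multiset.mem_cons_self _ _) (hΓ (.atom P) (Multiset.mem_cons_self _ _))
  | botL Γ Δ => exact fun _ w hΓ _ => hΓ .bot (Multiset.mem_cons_self _ _)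
  | impL Γ Δ A B d e ihd ihe =>
    intro hI w hΓ hΔ
    simp only [G3lp.inputs, Set.union_subset_iff] at hI
    simp only [Multiset.forall_mem_cons] at *
    rcases hΓ.1 with h | h
    · exact ihd hI.1 w hΓ.2 ⟨h, hΔ⟩
    · exact ihe hI.2 w ⟨h, hΓ.2⟩ hΔ
  | impR Γ Δ A B d ih =>
    intro hI w hΓ hΔ
    simp only [Multiset.forall_mem_cons] at *
    exact ih hI w ⟨hΔ.1.1, hΓ⟩ ⟨hΔ.1.2, hΔ.2⟩
  | justC Γ Δ c A hA d ih =>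
    intro hI w hΓ hΔ
    simp only [G3lp.inputs, Set.insert_subset_iff] at hI
    obtain ⟨v, -, hv⟩ := exists_acc_of_input hI.1 (hΔ _ (Multiset.mem_cons_self _ _))
    exact ih hI.2 v (by simp) (by simpa using hv)
  | justT Γ Δ t A d ih =>
    intro hI w hΓ hΔ
    simp only [G3lp.inputs, Set.insert_subset_iff] at hI
    have hF := hΔ _ (Multiset.mem_cons_self _ _)
    obtain ⟨v, hwv, hv⟩ := exists_acc_of_input hI.1 hF
    -- As `t:A` is also false, its truth can only stem from membership in `w.G`, which accessibility
    -- transports.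
    have hG := (hΓ _ (Multiset.mem_cons_self _ _)).resolve_right (not_not_intro hF)
    have hvG : (val (.just t A) v).1 := .inl (hwv t A hG (guarded_just_of_mem hI.1))
    exact ih hI.2 v (by simpa using hvG) (by simpa using hv)
  | justL Γ Δ t A d ih =>
    intro hI w hΓ hΔ
    simp only [Multiset.forall_mem_cons] at *
    exact ih hI w ⟨val_of_val_just hΓ.1, hΓ⟩ hΔ
  | bangR Γ Δ t A d ih =>
    intro hI w hΓ hΔ
    simp only [Multiset.forall_mem_cons] at *
    exact ih hI w hΓ ⟨val_bang hΔ.1, hΔ⟩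
  | sumR Γ Δ s t A d ih =>
    intro hI w hΓ hΔ
    simp only [Multiset.forall_mem_cons] at *
    exact ih hI w hΓ ⟨val_subterm (t := .sum s t) (Or.inl (.inl s.self_mem_subterms)) hΔ.1,
      val_subterm (t := .sum s t) (Or.inl (.inr t.self_mem_subterms)) hΔ.1, hΔ⟩
  | appR Γ Δ s t A B d e ihd ihe =>
    intro hI w hΓ hΔ
    simp only [G3lp.inputs, Set.union_subset_iff] at hI
    simp only [Multiset.forall_mem_cons] at *
    rcases val_app hΔ.1 A with h | h
    · exact ihd hI.1 w hΓ ⟨h, hΔ⟩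
    · exact ihe hI.2 w hΓ ⟨h, hΔ⟩

end World

/-! ### Completeness of the annotated calculus and conclusion -/

theorem derivable_of_g3lp {X : Set PropScheme} {A : LPFormula} (d : G3lp X 0 {A}) :
    Derivable d.inputs ⟨[], [A]⟩ := by
  by_contra h
  obtain ⟨w, -, hw⟩ := exists_world h
  exact World.sound d subset_rfl w (by simp)
    (by simpa using (World.val_of_mem A w).2 (hw A (by simp)))

theorem mainTheorem3 (X : Set PropScheme) (hX : AxiomatizesClassical X) (A : LPFormula)
    (d : G3lp X 0 {A}) (hd : ¬ SelfReferential d.inputs) :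
    ∃ T : G3sTree, T.IsProofOf ⟨[], [A.forget]⟩ ∧ ¬ T.HasPrehistoricCycle := by
  obtain ⟨T, hT⟩ := derivable_of_g3lp d
  obtain ⟨N, -, hN⟩ := hT.exists_annotation
  exact ⟨T, ⟨hT.correct, hT.root_eq⟩, fun h => hd (selfReferential_of_hasPrehistoricCycle hN h)⟩
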